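/- Let $\mathfrak g=\mathfrak g_{-1}\oplus\mathfrak g_0\oplus\mathfrak g_1$ be a $|1|$-graded real semisimple Lie algebra, i.e. $[\mathfrak g_i,\mathfrak g_j]\subset\mathfrak g_{i+j}$ (with $\mathfrak g_r=0$ for $|r|>1$) and no simple ideal of $\mathfrak g$ is contained in $\mathfrak g_0$; put $\mathfrak g^i=\bigoplus_{j\ge i}\mathfrak g_j$ and $\mathfrak p=\mathfrak g^0$. Let $G$ be a Lie group with Lie algebra $\mathfrak g$ and $P\subset G$ a Lie subgroup with Lie algebra $\mathfrak p$ such that $\mathrm{Ad}_g(\mathfrak g^i)\subset\mathfrak g^i$ for all $g\in P$ and all $i$. Let $(p:\mathcal G\to M,\omega)$ be a Cartan geometry of type $(G,P)$, that is, a smooth principal $P$-bundle with a smooth $\mathfrak g$-valued $1$-form $\omega$ on $\mathcal G$ that is $P$-equivariant, $(r^h)^*\omega=\mathrm{Ad}_{h^{-1}}\circ\omega$, reproduces the generators of fundamental vector fields, and restricts to a linear isomorphism $T_u\mathcal G\to\mathfrak g$ for each $u\in\mathcal G$. For $X\in\mathfrak g$ let $\omega^{-1}(X)$ be the vector field on $\mathcal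 G$ with $\omega(\omega^{-1}(X))=X$, let $$\kappa(u)(X,Y)=[X,Y]-\omega\big([\omega^{-1}(X),\omega^{-1}(Y)](u)\big),\qquad u\in\mathcal G,\ X,Y\in\mathfrak g,$$ be the curvature function, and let $\kappa_{-1}$ be its component with values in $\mathfrak g_{-1}$. The geometry is torsion free if $\kappa(u)(X,Y)\in\mathfrak p$ for all $u\in\mathcal G$ and $X,Y\in\mathfrak g$. A (local) symmetry with the center at $x\in M$ is a diffeomorphism $s$ between open subsets of $M$, defined at $x$, such that $s(x)=x$, $T_xs=-\mathrm{id}$ on $T_x^{-1}M$, and on some neighborhood of $x$ the map $s$ is covered by a (locally defined) automorphism of the Cartan geometry, i.e. by a $P$-equivariant diffeomorphism $\varphi$ between restrictions of $\mathcal G$ to open subsets of $M$ with $\varphi^*\omega=\omega$. Here $T_x^{-1}M=\{Tp\cdot\omega^{-1}(X)(u) : p(u)=x,\ X\in\mathfrak g^{-1}\}$, which is all of $T_xM$ for a $|1|$-grading. The geometry is locally symmetric if there is such a symmetry at each $x\in M$. Then: 1. If the geometry is locally symmetric, then it is torsion free. 2. If, for some $x\in M$, there is a symmetry with the center at $x$,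 then the torsion vanishes at $x$: $\kappa_{-1}(u)(X,Y)=0$ for all $u\in\mathcal G$ with $p(u)=x$ and all $X,Y\in\mathfrak g_{-1}$. -/

import Mathlib

open scoped Manifold ContDiff

noncomputable section

/-! ### Gradings of Lie algebras -/

/-- A `|k|`-grading `L = L_{-k} ⊕ ⋯ ⊕ L_k` of a real Lie algebra `L`: the pieces outside
`-k, …, k` vanish, the negative part is the subalgebra generated by `L_{-1}`, and no simple ideal
is contained in `L_0`. -/
structure LieGrading (k : ℕ) (L : Type*) [LieRing L] [LieAlgebra ℝ L] where
  /-- the graded pieces `L_i` -/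
  piece : ℤ → Submodule ℝ L
  isInternal : DirectSum.IsInternal piece
  piece_eq_bot : ∀ i : ℤ, (k : ℤ) < |i| → piece i = ⊥
  lie_mem : ∀ i j : ℤ, ∀ X ∈ piece i, ∀ Y ∈ piece j, ⁅X, Y⁆ ∈ piece (i + j)
  generated : (LieSubalgebra.lieSpan ℝ L (piece (-1) : Set L)).toSubmodule =
    ⨆ i : ℤ, ⨆ _ : i < 0, piece i
  no_simple_ideal : ∀ J : LieIdeal ℝ L, LieAlgebra.IsSimple ℝ J → ¬ (J.toSubmodule ≤ piece 0)

namespace LieGrading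

variable {k : ℕ} {L : Type*} [LieRing L] [LieAlgebra ℝ L]

/-- The filtration component `L^i = L_i ⊕ ⋯ ⊕ L_k`. -/
def filtration (gr : LieGrading k L) (i : ℤ) : Submodule ℝ L :=
  ⨆ j : ℤ, ⨆ _ : i ≤ j, gr.piece j

/-- The subalgebra `𝔭 = L^0`, as a subspace. -/
def parabolic (gr : LieGrading k L) : Submodule ℝ L := gr.filtration 0

/-- The component in `L_i` of an element of `L`. -/
def component (gr : LieGrading k L) (i : ℤ) (X : L) : L :=
  letI := gr.isInternal.chooseDecomposition
  (DirectSum.decompose gr.piece X i : L)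

end LieGrading

/-! ### Lie groups -/

section LieGroups

variable {EG : Type*} [NormedAddCommGroup EG] [NormedSpace ℝ EG]
  {G : Type*} [TopologicalSpace G] [ChartedSpace EG G] [Group G]

/-- A smooth real Lie group has the smoothness that the Lie bracket on `T_1 G` requires. -/
instance instLieGroupMinSmoothness [LieGroup 𝓘(ℝ, EG) ∞ G] :
    LieGroup 𝓘(ℝ, EG) (minSmoothness ℝ 3) G :=
  LieGroup.of_le (n := ∞) (by
    rw [minSmoothness_of_isRCLikeNormedField]
    exact ENat.LEInfty.out)

/-- The adjoint action `Ad_g` on the Lie algebra `T_1 G`: the derivative at `1` of the conjugation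
`a ↦ g a g⁻¹`. -/
def lieGroupAd (g : G) :
    GroupLieAlgebra 𝓘(ℝ, EG) G →L[ℝ] GroupLieAlgebra 𝓘(ℝ, EG) G :=
  mfderiv 𝓘(ℝ, EG) 𝓘(ℝ, EG) (fun a : G => g * a * g⁻¹) 1

/-- The inclusion of the Lie algebra of a Lie subgroup `P` into the Lie algebra of `G`. -/
def lieSubgroupIncl {EP : Type*} [NormedAddCommGroup EP] [NormedSpace ℝ EP]
    (P : Subgroup G) [ChartedSpace EP P] :
    GroupLieAlgebra 𝓘(ℝ, EP) P →L[ℝ] GroupLieAlgebra 𝓘(ℝ, EG) G :=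
  mfderiv 𝓘(ℝ, EP) 𝓘(ℝ, EG) (fun h : P => (h : G)) 1

/-- `P` is a parabolic subgroup of `G` for the given grading of the Lie algebra of `G`: a Lie
subgroup with Lie algebra `𝔭`, all elements of which preserve the filtration under `Ad`.
These are exactly the subgroups that lie between the group of all elements of `G` that
preserve the filtration and its identity component. -/
structure IsParabolicSubgroup {EP : Type*} [NormedAddCommGroup EP] [NormedSpace ℝ EP]
    [CompleteSpace EG] [LieGroup 𝓘(ℝ, EG) ∞ G] {k : ℕ}
    (gr : LieGrading k (GroupLieAlgebra 𝓘(ℝ, EG) G))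
    (P : Subgroup G) [ChartedSpace EP P] : Prop where
  isSmoothEmbedding :
    Manifold.IsSmoothEmbedding 𝓘(ℝ, EP) 𝓘(ℝ, EG) ∞ (fun h : P => (h : G))
  lieAlgebra_eq : LinearMap.range (lieSubgroupIncl (EG := EG) (EP := EP) P).toLinearMap =
    gr.parabolic
  ad_mem : ∀ g ∈ P, ∀ i : ℤ, ∀ X ∈ gr.filtration i, lieGroupAd g X ∈ gr.filtration i

end LieGroups

/-! ### Principal bundles and Cartan geometries -/

/-- A smooth principal bundle with total space `B`, base `M` and structure group `P`: a smooth
right action of `P` on `B` and a projection `B → M` that admits, around each point of `M`, a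
smooth `P`-equivariant trivialization. -/
structure PrincipalBundle
    {EP : Type*} [NormedAddCommGroup EP] [NormedSpace ℝ EP]
    (P : Type*) [TopologicalSpace P] [ChartedSpace EP P] [Group P]
    {EM : Type*} [NormedAddCommGroup EM] [NormedSpace ℝ EM]
    (M : Type*) [TopologicalSpace M] [ChartedSpace EM M]
    {EB : Type*} [NormedAddCommGroup EB] [NormedSpace ℝ EB]
    (B : Type*) [TopologicalSpace B] [ChartedSpace EB B] where
  /-- the projection to the base -/
  proj : B → M
  /-- the right action `(u, h) ↦ u · h` -/
  act : B → P → B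
  contMDiff_proj : ContMDiff 𝓘(ℝ, EB) 𝓘(ℝ, EM) ∞ proj
  contMDiff_act :
    ContMDiff (𝓘(ℝ, EB).prod 𝓘(ℝ, EP)) 𝓘(ℝ, EB) ∞ (fun q : B × P => act q.1 q.2)
  act_one : ∀ u, act u 1 = u
  act_mul : ∀ u h h', act u (h * h') = act (act u h) h'
  proj_act : ∀ u h, proj (act u h) = proj u
  exists_trivialization : ∀ x : M, ∃ (U : Set M) (Ψ : OpenPartialHomeomorph B (M × P)),
    IsOpen U ∧ x ∈ U ∧ Ψ.source = proj ⁻¹' U ∧ Ψ.target = U ×ˢ Set.univ ∧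
    ContMDiffOn 𝓘(ℝ, EB) (𝓘(ℝ, EM).prod 𝓘(ℝ, EP)) ∞ Ψ Ψ.source ∧
    ContMDiffOn (𝓘(ℝ, EM).prod 𝓘(ℝ, EP)) 𝓘(ℝ, EB) ∞ Ψ.symm Ψ.target ∧
    (∀ u ∈ Ψ.source, (Ψ u).1 = proj u) ∧
    (∀ u ∈ Ψ.source, ∀ h, Ψ (act u h) = ((Ψ u).1, (Ψ u).2 * h))

namespace PrincipalBundle

variable {EP : Type*} [NormedAddCommGroup EP] [NormedSpace ℝ EP]
    {P : Type*} [TopologicalSpace P] [ChartedSpace EP P] [Group P]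
    {EM : Type*} [NormedAddCommGroup EM] [NormedSpace ℝ EM]
    {M : Type*} [TopologicalSpace M] [ChartedSpace EM M]
    {EB : Type*} [NormedAddCommGroup EB] [NormedSpace ℝ EB]
    {B : Type*} [TopologicalSpace B] [ChartedSpace EB B]

/-- The fundamental vector field `ζ_X` of `X` in the Lie algebra of `P`: its value at `u` is the
derivative at `1` of `h ↦ u · h` in the direction `X`. -/
def fundamentalField (E : PrincipalBundle (EP := EP) (EM := EM) (EB := EB) P M B)
    (X : GroupLieAlgebra 𝓘(ℝ, EP) P) (u : B) : TangentSpace 𝓘(ℝ, EB) u :=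
  (mfderiv 𝓘(ℝ, EP) 𝓘(ℝ, EB) (fun h : P => E.act u h) 1 :
    GroupLieAlgebra 𝓘(ℝ, EP) P →L[ℝ] TangentSpace 𝓘(ℝ, EB) u) X

end PrincipalBundle

/-- A Cartan geometry of type `(G, P)` on `M`: a principal `P`-bundle `B → M` with a Cartan
connection `ω`, which is a smooth `1`-form on `B` with values in the Lie algebra of `G`. -/
structure CartanGeometry
    {EG : Type*} [NormedAddCommGroup EG] [NormedSpace ℝ EG]
    {G : Type*} [TopologicalSpace G] [ChartedSpace EG G] [Group G]
    {EP : Type*} [NormedAddCommGroup EP] [NormedSpace ℝ EP]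
    (P : Subgroup G) [ChartedSpace EP P]
    {EM : Type*} [NormedAddCommGroup EM] [NormedSpace ℝ EM]
    (M : Type*) [TopologicalSpace M] [ChartedSpace EM M]
    {EB : Type*} [NormedAddCommGroup EB] [NormedSpace ℝ EB]
    (B : Type*) [TopologicalSpace B] [ChartedSpace EB B] [IsManifold 𝓘(ℝ, EB) ∞ B]
    extends PrincipalBundle (EP := EP) (EM := EM) (EB := EB) P M B where
  /-- the Cartan connection `ω`, an isomorphism `T_u B ≃ 𝔤` for each `u` -/
  conn : ∀ u : B, TangentSpace 𝓘(ℝ, EB) u ≃L[ℝ] GroupLieAlgebra 𝓘(ℝ, EG) G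
  contMDiff_conn : ContMDiff (M' := EG) 𝓘(ℝ, EB).tangent 𝓘(ℝ, EG) ∞
    (fun v : TangentBundle 𝓘(ℝ, EB) B => conn v.1 v.2)
  equivariant : ∀ (h : P) (u : B) (ξ : TangentSpace 𝓘(ℝ, EB) u),
    conn (act u h) (mfderiv 𝓘(ℝ, EB) 𝓘(ℝ, EB) (fun v : B => act v h) u ξ) =
      lieGroupAd (h : G)⁻¹ (conn u ξ)
  fundamental : ∀ (X : GroupLieAlgebra 𝓘(ℝ, EP) P) (u : B),
    conn u (toPrincipalBundle.fundamentalField X u) = lieSubgroupIncl P X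

namespace CartanGeometry

variable {EG : Type*} [NormedAddCommGroup EG] [NormedSpace ℝ EG]
  {G : Type*} [TopologicalSpace G] [ChartedSpace EG G] [Group G]
  {EP : Type*} [NormedAddCommGroup EP] [NormedSpace ℝ EP]
  {P : Subgroup G} [ChartedSpace EP P]
  {EM : Type*} [NormedAddCommGroup EM] [NormedSpace ℝ EM]
  {M : Type*} [TopologicalSpace M] [ChartedSpace EM M]
  {EB : Type*} [NormedAddCommGroup EB] [NormedSpace ℝ EB]
  {B : Type*} [TopologicalSpace B] [ChartedSpace EB B] [IsManifold 𝓘(ℝ, EB) ∞ B]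

/-- The constant vector field `ω⁻¹(X)` on `B`. -/
def constField (𝒢 : CartanGeometry (EG := EG) (EP := EP) (EM := EM) (EB := EB) P M B)
    (X : GroupLieAlgebra 𝓘(ℝ, EG) G) (u : B) : TangentSpace 𝓘(ℝ, EB) u :=
  (𝒢.conn u).symm X

/-- The curvature function `κ(u)(X, Y) = [X, Y] - ω([ω⁻¹(X), ω⁻¹(Y)](u))`. -/
def curvature (𝒢 : CartanGeometry (EG := EG) (EP := EP) (EM := EM) (EB := EB) P M B)
    (u : B) (X Y : GroupLieAlgebra 𝓘(ℝ, EG) G) : GroupLieAlgebra 𝓘(ℝ, EG) G :=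
  ⁅X, Y⁆ - 𝒢.conn u (VectorField.mlieBracket 𝓘(ℝ, EB) (𝒢.constField X) (𝒢.constField Y) u)

/-- A (locally defined) automorphism `φ` of the Cartan geometry: a `P`-equivariant diffeomorphism
between the restrictions of `B` to open sets `U` and `V` of `M`, with `φ^* ω = ω`. -/
structure IsLocalAutomorphism
    (𝒢 : CartanGeometry (EG := EG) (EP := EP) (EM := EM) (EB := EB) P M B)
    (U V : Set M) (φ : OpenPartialHomeomorph B B) : Prop where
  isOpen_source : IsOpen U
  isOpen_target : IsOpen V
  source_eq : φ.source = 𝒢.proj ⁻¹' U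
  target_eq : φ.target = 𝒢.proj ⁻¹' V
  contMDiffOn : ContMDiffOn 𝓘(ℝ, EB) 𝓘(ℝ, EB) ∞ φ φ.source
  contMDiffOn_symm : ContMDiffOn 𝓘(ℝ, EB) 𝓘(ℝ, EB) ∞ φ.symm φ.target
  map_act : ∀ u ∈ φ.source, ∀ h : P, φ (𝒢.act u h) = 𝒢.act (φ u) h
  pullback_conn : ∀ u ∈ φ.source, ∀ ξ : TangentSpace 𝓘(ℝ, EB) u,
    𝒢.conn (φ u) (mfderiv 𝓘(ℝ, EB) 𝓘(ℝ, EB) φ u ξ) = 𝒢.conn u ξ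

variable [CompleteSpace EG] [LieGroup 𝓘(ℝ, EG) ∞ G] {k : ℕ}

/-- The component `T^i M` at `x` of the filtration of the tangent bundle: the vectors
`Tp · ω⁻¹(X)(u)` with `u` over `x` and `X ∈ 𝔤^i`. -/
def tangentFiltration
    (𝒢 : CartanGeometry (EG := EG) (EP := EP) (EM := EM) (EB := EB) P M B)
    (gr : LieGrading k (GroupLieAlgebra 𝓘(ℝ, EG) G)) (i : ℤ) (x : M) :
    Set (TangentSpace 𝓘(ℝ, EM) x) :=
  {v | ∃ u : B, 𝒢.proj u = x ∧ ∃ X ∈ gr.filtration i,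
    v = (mfderiv 𝓘(ℝ, EB) 𝓘(ℝ, EM) 𝒢.proj u (𝒢.constField X u) : EM)}

/-- `s` is a (locally defined) symmetry with the center at `x`: a diffeomorphism between open
sets of `M` that fixes `x`, whose differential at `x` is `-id` on `T^{-1}_x M`, and that is covered
near `x` by an automorphism of the Cartan geometry. -/
structure IsSymmetryAt
    (𝒢 : CartanGeometry (EG := EG) (EP := EP) (EM := EM) (EB := EB) P M B)
    (gr : LieGrading k (GroupLieAlgebra 𝓘(ℝ, EG) G)) (x : M)
    (s : OpenPartialHomeomorph M M) : Prop where
  mem_source : x ∈ s.source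
  contMDiffOn : ContMDiffOn 𝓘(ℝ, EM) 𝓘(ℝ, EM) ∞ s s.source
  contMDiffOn_symm : ContMDiffOn 𝓘(ℝ, EM) 𝓘(ℝ, EM) ∞ s.symm s.target
  map_center : s x = x
  mfderiv_eq_neg : ∀ v ∈ 𝒢.tangentFiltration gr (-1) x,
    (mfderiv 𝓘(ℝ, EM) 𝓘(ℝ, EM) s x v : EM) = -v
  covered : ∃ (U V : Set M) (φ : OpenPartialHomeomorph B B), x ∈ U ∧ U ⊆ s.source ∧
    𝒢.IsLocalAutomorphism U V φ ∧ ∀ u ∈ φ.source, 𝒢.proj (φ u) = s (𝒢.proj u)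

/-- The geometry is locally symmetric: there is a local symmetry at each point. -/
def IsLocallySymmetric
    (𝒢 : CartanGeometry (EG := EG) (EP := EP) (EM := EM) (EB := EB) P M B)
    (gr : LieGrading k (GroupLieAlgebra 𝓘(ℝ, EG) G)) : Prop :=
  ∀ x : M, ∃ s : OpenPartialHomeomorph M M, 𝒢.IsSymmetryAt gr x s

/-- The geometry is torsion free: the curvature function has values in `𝔭`. -/
def IsTorsionFree
    (𝒢 : CartanGeometry (EG := EG) (EP := EP) (EM := EM) (EB := EB) P M B)
    (gr : LieGrading k (GroupLieAlgebra 𝓘(ℝ, EG) G)) : Prop :=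
  ∀ (u : B) (X Y : GroupLieAlgebra 𝓘(ℝ, EG) G), 𝒢.curvature u X Y ∈ gr.parabolic

/-- The component `κ_j` of the curvature function with values in `𝔤_j`. -/
def curvatureComponent
    (𝒢 : CartanGeometry (EG := EG) (EP := EP) (EM := EM) (EB := EB) P M B)
    (gr : LieGrading k (GroupLieAlgebra 𝓘(ℝ, EG) G)) (j : ℤ) (u : B)
    (X Y : GroupLieAlgebra 𝓘(ℝ, EG) G) : GroupLieAlgebra 𝓘(ℝ, EG) G :=
  gr.component j (𝒢.curvature u X Y)

end CartanGeometry

end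

/-! Let `φ` cover a symmetry at `x` and let `u` lie over `x`. Since `φ u` lies in the same fibre, `φ
u = u · g` for some `g ∈ P`. Comparing `φ` with right translation by `g`, the condition `T_x s =
-id` says exactly that `Ad_g X + X ∈ 𝔭` for every `X ∈ 𝔤`; here the `|1|`-grading enters through
`𝔤^{-1} = 𝔤` (`exists_lieGroupAd_add_eq`). The curvature vanishes as soon as one argument lies in
`𝔭` (`curvature_lieSubgroupIncl`), so `κ(u)(Ad_g X, Ad_g Y) = κ(u)(-X, -Y) = κ(u)(X, Y)`.
Equivariance (`curvature_act`) and invariance under automorphisms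
(`IsLocalAutomorphism.curvature_eq`) then give `Ad_g W = W` for `W = κ(u)(X, Y)`. But also `Ad_g W +
W ∈ 𝔭`, so `2 W ∈ 𝔭`. Both claims follow. The analytic weight lies in horizontality, i.e. `[ζ_X,
ω⁻¹(Y)] = ω⁻¹([X, Y])`. Instead of flows, the argument uses the symmetry of the second derivative of
the action map in charts (`lieBracket_eq_fderiv_of_partial`, `mlieBracket_eq_mfderiv_of_act`). -/

/-! ### Brackets with the generator of an action, in vector spaces. -/

/-- Suppose `μ (·, z₀) = id`, `V` is the field `∂₂μ (·, z₀) X` and `b z` is mapped by `∂₁μ (y₀, z)` to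
the value of `W` at `μ (y₀, z)`. Then `[V, W]` at `y₀` is the derivative of `b` in direction `X`. -/
theorem lieBracket_eq_fderiv_of_partial {E F : Type*} [NormedAddCommGroup E] [NormedSpace ℝ E]
    [NormedAddCommGroup F] [NormedSpace ℝ F] {μ : E × F → E} {y₀ : E} {z₀ : F}
    (hμ : ContDiffAt ℝ 2 μ (y₀, z₀)) (hid : ∀ᶠ y in nhds y₀, μ (y, z₀) = y)
    {V W : E → E} {X : F} (hV : ∀ᶠ y in nhds y₀, V y = fderiv ℝ (fun z => μ (y, z)) z₀ X)
    (hW : DifferentiableAt ℝ W y₀) {b : F → E} (hb : DifferentiableAt ℝ b z₀)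
    (hbW : ∀ᶠ z in nhds z₀, fderiv ℝ (fun y => μ (y, z)) y₀ (b z) = W (μ (y₀, z))) :
    VectorField.lieBracket ℝ V W y₀ = fderiv ℝ b z₀ X := by
  have hμ' : ∀ᶠ q in nhds (y₀, z₀), DifferentiableAt ℝ μ q :=
    (hμ.eventually (by simp)).mono fun q hq => hq.differentiableAt (by simp)
  have hD : DifferentiableAt ℝ (fderiv ℝ μ) (y₀, z₀) :=
    (hμ.fderiv_right (m := 1) (by norm_num)).differentiableAt (by simp)
  have hsymm : IsSymmSndFDerivAt ℝ μ (y₀, z₀) := hμ.isSymmSndFDerivAt (by simp)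
  have e1 : ∀ y z, HasFDerivAt (fun z => (y, z)) (ContinuousLinearMap.inr ℝ E F) z :=
    fun y z => hasFDerivAt_prodMk_right y z
  have e2 : ∀ y z, HasFDerivAt (fun y => (y, z)) (ContinuousLinearMap.inl ℝ E F) y :=
    fun y z => hasFDerivAt_prodMk_left y z
  have hV' : V =ᶠ[nhds y₀] fun y => fderiv ℝ μ (y, z₀) (0, X) := by
    have : ∀ᶠ y in nhds y₀, DifferentiableAt ℝ μ (y, z₀) :=
      (e2 y₀ z₀).continuousAt.eventually hμ'
    filter_upwards [hV, this] with y h1 h2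
    rw [h1]
    have := (h2.hasFDerivAt.comp z₀ (e1 y z₀)).fderiv
    rw [Function.comp_def] at this
    rw [this]; simp
  have hbW' : (fun z => W (μ (y₀, z))) =ᶠ[nhds z₀] fun z => fderiv ℝ μ (y₀, z) (b z, 0) := by
    have : ∀ᶠ z in nhds z₀, DifferentiableAt ℝ μ (y₀, z) :=
      (e1 y₀ z₀).continuousAt.eventually hμ'
    filter_upwards [hbW, this] with z h1 h2
    rw [← h1]
    have := (h2.hasFDerivAt.comp y₀ (e2 y₀ z)).fderiv
    rw [Function.comp_def] at this
    rw [this]; simp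
  have hinl : ∀ w : E, fderiv ℝ μ (y₀, z₀) (w, 0) = w := by
    intro w
    have h1 := (hμ'.self_of_nhds.hasFDerivAt.comp y₀ (e2 y₀ z₀)).fderiv
    have h2 : fderiv ℝ (fun y => μ (y, z₀)) y₀ = ContinuousLinearMap.id ℝ E := by
      have : (fun y => μ (y, z₀)) =ᶠ[nhds y₀] id := hid
      rw [this.fderiv_eq, fderiv_id]
    have h3 := congrArg (fun l : E →L[ℝ] E => l w) (h1.symm.trans h2)
    simpa using h3
  have hb0 : b z₀ = W y₀ := by
    have := hbW'.self_of_nhds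
    beta_reduce at this
    rw [hinl, hid.self_of_nhds] at this
    exact this.symm
  have hVd : HasFDerivAt V (((fderiv ℝ (fderiv ℝ μ) (y₀, z₀)).comp
      (ContinuousLinearMap.inl ℝ E F)).flip (0, X)) y₀ := by
    have h1 := (hD.hasFDerivAt.comp y₀ (e2 y₀ z₀)).clm_apply
      (hasFDerivAt_const ((0, X) : E × F) y₀)
    refine (h1.congr_of_eventuallyEq hV').congr_fderiv ?_
    ext w; simp
  have hbd : HasFDerivAt (fun z => (b z, (0 : F)))
      ((ContinuousLinearMap.inl ℝ E F).comp (fderiv ℝ b z₀)) z₀ :=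
    (ContinuousLinearMap.inl ℝ E F).hasFDerivAt.comp z₀ hb.hasFDerivAt
  have hR := ((hD.hasFDerivAt.comp z₀ (e1 y₀ z₀)).clm_apply hbd).fderiv
  have hW' : HasFDerivAt W (fderiv ℝ W y₀) (μ (y₀, z₀)) := by
    rw [hid.self_of_nhds]; exact hW.hasFDerivAt
  have hL := (hW'.comp z₀ (hμ'.self_of_nhds.hasFDerivAt.comp z₀ (e1 y₀ z₀))).fderiv
  -- Differentiating `W (μ (y₀, z)) = ∂₁μ (y₀, z) (b z)` at `z₀` along `X` gives `DW (V) = D²μ (0,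
  -- X) (W, 0) + Db (X)`. Since `DV (W) = D²μ (W, 0) (0, X)`, symmetry of `D²μ` leaves only `Db (X)`
  -- in the bracket.
  have key := congrArg (fun l : F →L[ℝ] E => l X) (hL.symm.trans (hbW'.fderiv_eq.trans hR))
  have hs := hsymm (0, X) (W y₀, 0)
  have hVy : V y₀ = fderiv ℝ μ (y₀, z₀) (0, X) := hV'.self_of_nhds
  rw [VectorField.lieBracket, hVd.fderiv]
  simp [hinl, hb0] at key hs ⊢
  rw [hVy, key, hs]
  abel

/-! ### Charts, and derivatives read in the model spaces. -/

section
variable {EM : Type*} [NormedAddCommGroup EM] [NormedSpace ℝ EM]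
  {M : Type*} [TopologicalSpace M] [ChartedSpace EM M]

/-- The bracket on a manifold is defined by pulling fields back along the inverse chart; this turns
the inverse derivative occurring there into the derivative of the chart. -/
theorem inverse_mfderivWithin_extChartAt_symm [IsManifold 𝓘(ℝ, EM) 1 M] {u : M} {y : EM}
    (hy : y ∈ (extChartAt 𝓘(ℝ, EM) u).target) :
    (mfderivWithin 𝓘(ℝ, EM) 𝓘(ℝ, EM) (extChartAt 𝓘(ℝ, EM) u).symm (Set.range 𝓘(ℝ, EM)) y).inverse =
      mfderiv 𝓘(ℝ, EM) 𝓘(ℝ, EM) (extChartAt 𝓘(ℝ, EM) u) ((extChartAt 𝓘(ℝ, EM) u).symm y) :=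
  ContinuousLinearMap.inverse_eq
    (mfderivWithin_extChartAt_symm_comp_mfderiv_extChartAt hy)
    (mfderiv_extChartAt_comp_mfderivWithin_extChartAt_symm hy)

theorem hasMFDerivAt_extChartAt_symm_self [IsManifold 𝓘(ℝ, EM) 1 M] (u : M) :
    HasMFDerivAt 𝓘(ℝ, EM) 𝓘(ℝ, EM) (extChartAt 𝓘(ℝ, EM) u).symm (extChartAt 𝓘(ℝ, EM) u u)
      (ContinuousLinearMap.id ℝ EM) := by
  have h : mfderivWithin 𝓘(ℝ, EM) 𝓘(ℝ, EM) (extChartAt 𝓘(ℝ, EM) u).symm (Set.range 𝓘(ℝ, EM))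
      (extChartAt 𝓘(ℝ, EM) u u) = ContinuousLinearMap.id ℝ EM :=
    mfderivWithin_range_extChartAt_symm
  have h1 := mdifferentiableWithinAt_extChartAt_symm (I := 𝓘(ℝ, EM))
      (mem_extChartAt_target (I := 𝓘(ℝ, EM)) u)
  rw [modelWithCornersSelf_coe, Set.range_id, mdifferentiableWithinAt_univ] at h1
  rw [modelWithCornersSelf_coe, Set.range_id, mfderivWithin_univ] at h
  have h2 := h1.hasMFDerivAt
  rwa [h] at h2

section modelDeriv

variable {EN : Type*} [NormedAddCommGroup EN] [NormedSpace ℝ EN]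
  {N : Type*} [TopologicalSpace N] [ChartedSpace EN N]
  {EK : Type*} [NormedAddCommGroup EK] [NormedSpace ℝ EK]
  {K : Type*} [TopologicalSpace K] [ChartedSpace EK K]

/-- The derivative of a map between manifolds, as a linear map between the model spaces. -/
noncomputable def modelDeriv (f : M → N) (x : M) : EM →L[ℝ] EN :=
  mfderiv 𝓘(ℝ, EM) 𝓘(ℝ, EN) f x

theorem MDifferentiableAt.hasMFDerivAt_modelDeriv {f : M → N} {x : M}
    (hf : MDifferentiableAt 𝓘(ℝ, EM) 𝓘(ℝ, EN) f x) :
    HasMFDerivAt 𝓘(ℝ, EM) 𝓘(ℝ, EN) f x (modelDeriv f x : EM →L[ℝ] EN) :=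
  hf.hasMFDerivAt

theorem modelDeriv_eq {f : M → N} {x : M} {D : EM →L[ℝ] EN}
    (hf : HasMFDerivAt 𝓘(ℝ, EM) 𝓘(ℝ, EN) f x D) : modelDeriv f x = D :=
  hf.mfderiv

/-- The base point `y` is kept separate from `f x`, so that maps can be composed at points that are
equal only propositionally, such as `act u 1` and `u`. -/
theorem HasMFDerivAt.comp_model {f : M → N} {g : N → K} {x : M} {y : N} {D : EM →L[ℝ] EN}
    {D' : EN →L[ℝ] EK} (hg : HasMFDerivAt 𝓘(ℝ, EN) 𝓘(ℝ, EK) g y D') (hxy : f x = y)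
    (hf : HasMFDerivAt 𝓘(ℝ, EM) 𝓘(ℝ, EN) f x D) :
    HasMFDerivAt 𝓘(ℝ, EM) 𝓘(ℝ, EK) (fun x => g (f x)) x (D'.comp D : EM →L[ℝ] EK) := by
  subst hxy
  exact hg.comp x hf

theorem modelDeriv_comp {f : M → N} {g : N → K} {x : M} {y : N}
    (hg : MDifferentiableAt 𝓘(ℝ, EN) 𝓘(ℝ, EK) g y) (hxy : f x = y)
    (hf : MDifferentiableAt 𝓘(ℝ, EM) 𝓘(ℝ, EN) f x) :
    modelDeriv (fun x => g (f x)) x =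
      ((modelDeriv g y : EN →L[ℝ] EK).comp (modelDeriv f x) : EM →L[ℝ] EK) :=
  modelDeriv_eq (hg.hasMFDerivAt_modelDeriv.comp_model hxy hf.hasMFDerivAt_modelDeriv)

theorem modelDeriv_id {x : M} : modelDeriv (fun x : M => x) x = ContinuousLinearMap.id ℝ EM :=
  modelDeriv_eq (hasMFDerivAt_id x)

end modelDeriv

end

/-! ### Brackets with the generator of an action, on manifolds. -/

section mlieBracket

variable {EM : Type*} [NormedAddCommGroup EM] [NormedSpace ℝ EM] [CompleteSpace EM]
  {M : Type*} [TopologicalSpace M] [ChartedSpace EM M] [IsManifold 𝓘(ℝ, EM) ∞ M]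
  {EN : Type*} [NormedAddCommGroup EN] [NormedSpace ℝ EN]
  {N : Type*} [TopologicalSpace N] [ChartedSpace EN N] [IsManifold 𝓘(ℝ, EN) ∞ N]

/-- In the preferred charts at `u` and `n₀`, whose derivatives at the centers are the identity, this
is the vector space statement. Only `m v n₀ = v` is required of `m`. It serves twice: for `P` acting
on `G` by right multiplication and for the principal action on `B`. -/
theorem mlieBracket_eq_mfderiv_of_act {m : M → N → M}
    (hm : ContMDiff (𝓘(ℝ, EM).prod 𝓘(ℝ, EN)) 𝓘(ℝ, EM) ∞ (fun q : M × N => m q.1 q.2))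
    {n₀ : N} (hm1 : ∀ v, m v n₀ = v) {u : M} {X : EN}
    {V W : ∀ v : M, TangentSpace 𝓘(ℝ, EM) v}
    (hV : ∀ v, V v = (modelDeriv (fun n => m v n) n₀ : EN →L[ℝ] EM) X)
    (hW : MDifferentiableAt 𝓘(ℝ, EM) 𝓘(ℝ, EM).tangent
      (fun v => (⟨v, W v⟩ : TangentBundle 𝓘(ℝ, EM) M)) u)
    {b : N → EM} (hb : MDifferentiableAt 𝓘(ℝ, EN) 𝓘(ℝ, EM) b n₀)
    (hbW : ∀ n, (modelDeriv (fun v => m v n) u : EM →L[ℝ] EM) (b n) = W (m u n)) :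
    VectorField.mlieBracket 𝓘(ℝ, EM) V W u = (modelDeriv b n₀ : EN →L[ℝ] EM) X := by
  have : IsManifold 𝓘(ℝ, EM) 1 M := IsManifold.of_le (n := ∞) (by simp)
  have : IsManifold 𝓘(ℝ, EN) 1 N := IsManifold.of_le (n := ∞) (by simp)
  have : IsManifold 𝓘(ℝ, EN) 2 N := IsManifold.of_le (n := ∞) ENat.LEInfty.out
  have : IsManifold 𝓘(ℝ, EM) 2 M := IsManifold.of_le (n := ∞) ENat.LEInfty.out
  set e := extChartAt 𝓘(ℝ, EM) u with he
  set c := extChartAt 𝓘(ℝ, EN) n₀ with hc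
  let V' : EM → EM :=
    VectorField.mpullbackWithin 𝓘(ℝ, EM) 𝓘(ℝ, EM) e.symm V (Set.range 𝓘(ℝ, EM))
  let W' : EM → EM :=
    VectorField.mpullbackWithin 𝓘(ℝ, EM) 𝓘(ℝ, EM) e.symm W (Set.range 𝓘(ℝ, EM))
  have hrange : e.symm ⁻¹' Set.univ ∩ Set.range 𝓘(ℝ, EM) = Set.univ := by
    rw [Set.preimage_univ, Set.univ_inter, modelWithCornersSelf_coe, Set.range_id]
  have hbr : (VectorField.mlieBracket 𝓘(ℝ, EM) V W u : EM) =
      VectorField.lieBracket ℝ V' W' (e u) := by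
    have h1 : (mfderiv 𝓘(ℝ, EM) 𝓘(ℝ, EM) e u).inverse = ContinuousLinearMap.id ℝ EM := by
      rw [he, mfderiv_extChartAt_self]
      exact ContinuousLinearMap.inverse_id
    rw [← VectorField.mlieBracketWithin_univ, VectorField.mlieBracketWithin_apply]
    refine (congrArg (fun l : EM →L[ℝ] EM => l _) h1).trans ?_
    change VectorField.lieBracketWithin ℝ V' W' (e.symm ⁻¹' Set.univ ∩ Set.range 𝓘(ℝ, EM)) (e u) = _
    rw [hrange, VectorField.lieBracketWithin_univ]
  have hfW : DifferentiableAt ℝ W' (e u) := by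
    have h1 : DifferentiableWithinAt ℝ W' (e.symm ⁻¹' Set.univ ∩ Set.range 𝓘(ℝ, EM)) (e u) :=
      (mdifferentiableWithinAt_univ.2 hW).differentiableWithinAt_mpullbackWithin_vectorField
    rwa [hrange, differentiableWithinAt_univ] at h1
  have hV' : ∀ y ∈ e.target, V' y = (modelDeriv e (e.symm y) : EM →L[ℝ] EM) (V (e.symm y)) :=
    fun y hy => congrArg (fun l : EM →L[ℝ] EM => l (V (e.symm y)))
      (inverse_mfderivWithin_extChartAt_symm hy)
  have hW' : ∀ y ∈ e.target, W' y = (modelDeriv e (e.symm y) : EM →L[ℝ] EM) (W (e.symm y)) :=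
    fun y hy => congrArg (fun l : EM →L[ℝ] EM => l (W (e.symm y)))
      (inverse_mfderivWithin_extChartAt_symm hy)
  have heu : e.symm (e u) = u := extChartAt_to_inv u
  have hcn : c.symm (c n₀) = n₀ := extChartAt_to_inv n₀
  have hcd := hasMFDerivAt_extChartAt_symm_self (M := N) (EM := EN) n₀
  have hed := hasMFDerivAt_extChartAt_symm_self (M := M) (EM := EM) u
  have hmn : ∀ v n, MDifferentiableAt 𝓘(ℝ, EN) 𝓘(ℝ, EM) (fun n => m v n) n := fun v n =>
    ((hm.comp (contMDiff_const.prodMk contMDiff_id)).contMDiffAt).mdifferentiableAt (by simp)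
  have hmv : ∀ v n, MDifferentiableAt 𝓘(ℝ, EM) 𝓘(ℝ, EM) (fun v => m v n) v := fun v n =>
    ((hm.comp (contMDiff_id.prodMk contMDiff_const)).contMDiffAt).mdifferentiableAt (by simp)
  have hbt : HasFDerivAt (fun z => b (c.symm z)) (modelDeriv b n₀ : EN →L[ℝ] EM) (c n₀) :=
    (hb.hasMFDerivAt_modelDeriv.comp_model hcn hcd).hasFDerivAt
  have hetgt : e.target ∈ nhds (e u) := extChartAt_target_mem_nhds u
  rw [hbr, ← hbt.fderiv]
  have heD : ∀ v ∈ e.source, MDifferentiableAt 𝓘(ℝ, EM) 𝓘(ℝ, EM) e v := fun v hv =>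
    mdifferentiableAt_extChartAt (by rwa [he, extChartAt_source] at hv)
  have compV : ∀ v ∈ e.source, fderiv ℝ (fun z => e (m v (c.symm z))) (c n₀) X =
      (modelDeriv e v : EM →L[ℝ] EM) (V v) := by
    intro v hv
    have h1 := (heD v hv).hasMFDerivAt_modelDeriv.comp_model (hm1 v)
      (hmn v n₀).hasMFDerivAt_modelDeriv
    have h2 : HasFDerivAt (fun z => e (m v (c.symm z)))
      ((modelDeriv e v : EM →L[ℝ] EM).comp (modelDeriv (fun n => m v n) n₀ : EN →L[ℝ] EM)) (c n₀) :=
      (h1.comp_model hcn hcd).hasFDerivAt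
    rw [hV, h2.fderiv]
    rfl
  have compW : ∀ n, m u n ∈ e.source → fderiv ℝ (fun y => e (m (e.symm y) n)) (e u) (b n) =
      (modelDeriv e (m u n) : EM →L[ℝ] EM) (W (m u n)) := by
    intro n hn
    have h1 := (heD _ hn).hasMFDerivAt_modelDeriv.comp_model (f := fun v => m v n) rfl
      (hmv u n).hasMFDerivAt_modelDeriv
    have h2 : HasFDerivAt (fun y => e (m (e.symm y) n))
      ((modelDeriv e (m u n) : EM →L[ℝ] EM).comp
        (modelDeriv (fun v => m v n) u : EM →L[ℝ] EM)) (e u) :=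
      (h1.comp_model heu hed).hasFDerivAt
    rw [← hbW, h2.fderiv]
    rfl
  have hcc : ContinuousAt (fun z => m u (c.symm z)) (c n₀) :=
    (hmn u _).continuousAt.comp hcd.continuousAt
  refine lieBracket_eq_fderiv_of_partial (μ := fun q : EM × EN => e (m (e.symm q.1) (c.symm q.2)))
    ?_ ?_ ?_ hfW hbt.differentiableAt ?_
  · have h1 : ContMDiffAt (𝓘(ℝ, EM).prod 𝓘(ℝ, EN)) 𝓘(ℝ, EM) 2
        (fun q : EM × EN => e (m (e.symm q.1) (c.symm q.2))) (e u, c n₀) := by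
      have h2 : ContMDiffAt 𝓘(ℝ, EM) 𝓘(ℝ, EM) 2 e (m (e.symm (e u)) (c.symm (c n₀))) := by
        rw [heu, hcn, hm1]
        exact contMDiffAt_extChartAt
      have h3 : ContMDiffAt 𝓘(ℝ, EM) 𝓘(ℝ, EM) 2 e.symm (e u) :=
        (contMDiffOn_extChartAt_symm u).contMDiffAt hetgt
      have h4 : ContMDiffAt 𝓘(ℝ, EN) 𝓘(ℝ, EN) 2 c.symm (c n₀) :=
        (contMDiffOn_extChartAt_symm n₀).contMDiffAt (extChartAt_target_mem_nhds n₀)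
      have h5 : ContMDiffAt (𝓘(ℝ, EM).prod 𝓘(ℝ, EN)) (𝓘(ℝ, EM).prod 𝓘(ℝ, EN)) 2
          (fun q : EM × EN => (e.symm q.1, c.symm q.2)) (e u, c n₀) :=
        (h3.comp (e u, c n₀) contMDiffAt_fst).prodMk (h4.comp (e u, c n₀) contMDiffAt_snd)
      exact h2.comp (e u, c n₀) ((hm.of_le ENat.LEInfty.out).contMDiffAt.comp (e u, c n₀) h5)
    rw [← modelWithCornersSelf_prod, chartedSpaceSelf_prod] at h1
    exact h1.contDiffAt
  · filter_upwards [hetgt] with y hy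
    simp only [hcn, hm1, e.right_inv hy]
  · filter_upwards [hetgt] with y hy
    rw [hV' y hy, compV _ (e.map_target hy)]
  · have : ∀ᶠ z in nhds (c n₀), m u (c.symm z) ∈ e.source := by
      refine hcc.eventually_mem ?_
      rw [hcn, hm1]
      exact extChartAt_source_mem_nhds u
    filter_upwards [this] with z hz
    have h1 := hW' _ (e.map_source hz)
    rw [e.left_inv hz] at h1
    simp only [heu]
    rw [h1, compW _ hz]

end mlieBracket

/-! ### Tangent coordinates and pullbacks of vector fields. -/

section
variable {EM : Type*} [NormedAddCommGroup EM] [NormedSpace ℝ EM]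
  {M : Type*} [TopologicalSpace M] [ChartedSpace EM M]
  {EN : Type*} [NormedAddCommGroup EN] [NormedSpace ℝ EN]
  {N : Type*} [TopologicalSpace N] [ChartedSpace EN N]

/-- With unchanged base points, both coordinate changes go from a chart to itself and are trivial.
-/
theorem inTangentCoordinates_apply_of_eq [IsManifold 𝓘(ℝ, EM) 1 M] [IsManifold 𝓘(ℝ, EN) 1 N]
    {K : Type*} {f : K → M} {g : K → N} (φ : K → EM →L[ℝ] EN) {x₀ x : K}
    (hf : f x = f x₀) (hg : g x = g x₀) (v : EM) :
    inTangentCoordinates 𝓘(ℝ, EM) 𝓘(ℝ, EN) f g φ x₀ x v = φ x v := by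
  rw [inTangentCoordinates_eq _ _ _ (by rw [hf]; exact mem_chart_source EM _)
    (by rw [hg]; exact mem_chart_source EN _), hf, hg]
  have h1 : ∀ w, (tangentBundleCore 𝓘(ℝ, EM) M).coordChange (achart EM (f x₀)) (achart EM (f x₀))
      (f x₀) w = w := fun w =>
    (tangentBundleCore 𝓘(ℝ, EM) M).coordChange_self _ _ (mem_chart_source EM _) w
  have h2 : ∀ w, (tangentBundleCore 𝓘(ℝ, EN) N).coordChange (achart EN (g x₀)) (achart EN (g x₀))
      (g x₀) w = w := fun w =>
    (tangentBundleCore 𝓘(ℝ, EN) N).coordChange_self _ _ (mem_chart_source EN _) w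
  simp only [ContinuousLinearMap.comp_apply, h1, h2]

theorem vectorField_congr (V : ∀ x : M, TangentSpace 𝓘(ℝ, EM) x) {x y : M} (h : x = y) :
    @Eq EM (V x) (V y) := by
  subst h; rfl

theorem mpullback_eq_of_mfderiv_eq {f : M → N} {x : M} {V : ∀ x : M, TangentSpace 𝓘(ℝ, EM) x}
    {W : ∀ y : N, TangentSpace 𝓘(ℝ, EN) y} {D : EM ≃L[ℝ] EN}
    (hD : modelDeriv f x = (D : EM →L[ℝ] EN)) (h : (D : EM →L[ℝ] EN) (V x) = W (f x)) :
    VectorField.mpullback 𝓘(ℝ, EM) 𝓘(ℝ, EN) f W x = V x := by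
  have h1 : VectorField.mpullback 𝓘(ℝ, EM) 𝓘(ℝ, EN) f W x =
    ((modelDeriv f x : EM →L[ℝ] EN).inverse : EN →L[ℝ] EM) (W (f x)) := rfl
  rw [h1, hD, ContinuousLinearMap.inverse_equiv, ← h]
  exact D.symm_apply_apply (V x)

end

/-! ### The adjoint action and its derivative. -/

section

variable {EG : Type*} [NormedAddCommGroup EG] [NormedSpace ℝ EG]
  {G : Type*} [TopologicalSpace G] [ChartedSpace EG G] [Group G]

theorem lieGroupAd_one_apply (X : GroupLieAlgebra 𝓘(ℝ, EG) G) : lieGroupAd (1 : G) X = X := by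
  have h : (modelDeriv (fun a : G => (1 : G) * a * 1⁻¹) 1 : EG →L[ℝ] EG) =
      ContinuousLinearMap.id ℝ EG := by
    simp only [one_mul, inv_one, mul_one]
    exact modelDeriv_id
  exact congrArg (fun l : EG →L[ℝ] EG => l X) h

variable [LieGroup 𝓘(ℝ, EG) ∞ G]

theorem contMDiff_conj (g : G) :
    ContMDiff 𝓘(ℝ, EG) 𝓘(ℝ, EG) ∞ (fun a : G => g * a * g⁻¹) :=
  (contMDiff_const.mul contMDiff_id).mul contMDiff_const

theorem mdifferentiableAt_conj (g a : G) :
    MDifferentiableAt 𝓘(ℝ, EG) 𝓘(ℝ, EG) (fun a : G => g * a * g⁻¹) a :=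
  (contMDiff_conj g).contMDiffAt.mdifferentiableAt (by simp)

theorem mdifferentiableAt_mul_left' (g a : G) :
    MDifferentiableAt 𝓘(ℝ, EG) 𝓘(ℝ, EG) (fun a : G => g * a) a :=
  (contMDiff_mul_left (I := 𝓘(ℝ, EG)) (n := ∞)).contMDiffAt.mdifferentiableAt (by simp)

theorem mdifferentiableAt_mul_right' (g a : G) :
    MDifferentiableAt 𝓘(ℝ, EG) 𝓘(ℝ, EG) (fun a : G => a * g) a :=
  (contMDiff_mul_right (I := 𝓘(ℝ, EG)) (n := ∞)).contMDiffAt.mdifferentiableAt (by simp)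

theorem lieGroupAd_mul_apply (g h : G) (X : GroupLieAlgebra 𝓘(ℝ, EG) G) :
    lieGroupAd (g * h) X = lieGroupAd g (lieGroupAd h X) := by
  have h1 : (modelDeriv (fun a : G => (g * h) * a * (g * h)⁻¹) 1 : EG →L[ℝ] EG) =
      (modelDeriv (fun a : G => g * a * g⁻¹) 1 : EG →L[ℝ] EG).comp
        (modelDeriv (fun a : G => h * a * h⁻¹) 1) := by
    rw [← modelDeriv_comp (mdifferentiableAt_conj g 1) (by simp) (mdifferentiableAt_conj h 1)]
    congr 1
    ext a
    group
  exact congrArg (fun l : EG →L[ℝ] EG => l X) h1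

/-- The adjoint action of a group element, as a linear equivalence. -/
noncomputable def lieGroupAdEquiv (g : G) :
    GroupLieAlgebra 𝓘(ℝ, EG) G ≃L[ℝ] GroupLieAlgebra 𝓘(ℝ, EG) G :=
  ContinuousLinearEquiv.equivOfInverse (lieGroupAd g) (lieGroupAd g⁻¹)
    (fun X => by rw [← lieGroupAd_mul_apply, inv_mul_cancel, lieGroupAd_one_apply])
    (fun X => by rw [← lieGroupAd_mul_apply, mul_inv_cancel, lieGroupAd_one_apply])

/-- Differentiate `g (a b) g⁻¹ = (g a g⁻¹) (g b g⁻¹)` in `b` at `1`. -/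
theorem modelDeriv_conj_mulInvariantVectorField (g a : G) (X : GroupLieAlgebra 𝓘(ℝ, EG) G) :
    (modelDeriv (fun a : G => g * a * g⁻¹) a : EG →L[ℝ] EG) (mulInvariantVectorField X a) =
      mulInvariantVectorField (lieGroupAd g X) (g * a * g⁻¹) := by
  have h1 := modelDeriv_comp (mdifferentiableAt_conj (EG := EG) g a) (mul_one a)
    (mdifferentiableAt_mul_left' a 1)
  have h2 := modelDeriv_comp (mdifferentiableAt_mul_left' (EG := EG) (g * a * g⁻¹) 1)
    (by simp) (mdifferentiableAt_conj g 1)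
  have h3 : (fun b : G => g * (a * b) * g⁻¹) = fun b => (g * a * g⁻¹) * (g * b * g⁻¹) := by
    ext b; group
  rw [h3] at h1
  exact congrArg (fun l : EG →L[ℝ] EG => l X) (h1.symm.trans h2)

theorem exists_equiv_modelDeriv_conj (g a : G) : ∃ D : EG ≃L[ℝ] EG,
    modelDeriv (fun a : G => g * a * g⁻¹) a = (D : EG →L[ℝ] EG) := by
  have h : ∀ g a : G, (modelDeriv (fun a : G => g⁻¹ * a * g⁻¹⁻¹) (g * a * g⁻¹) : EG →L[ℝ] EG).comp
      (modelDeriv (fun a : G => g * a * g⁻¹) a) = ContinuousLinearMap.id ℝ EG := by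
    intro g a
    rw [← modelDeriv_comp (mdifferentiableAt_conj g⁻¹ _) rfl (mdifferentiableAt_conj g a),
      ← modelDeriv_id (x := a)]
    congr 1
    ext b
    group
  have h' := h g⁻¹ (g * a * g⁻¹)
  rw [inv_inv, show g⁻¹ * (g * a * g⁻¹) * g = a by group] at h'
  refine ⟨ContinuousLinearEquiv.equivOfInverse (modelDeriv (fun a : G => g * a * g⁻¹) a)
    (modelDeriv (fun a : G => g⁻¹ * a * g⁻¹⁻¹) (g * a * g⁻¹)) (fun X => ?_) (fun X => ?_), rfl⟩
  · exact congrArg (fun l : EG →L[ℝ] EG => l X) (h g a)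
  · rw [inv_inv]
    exact congrArg (fun l : EG →L[ℝ] EG => l X) h'

/-- Conjugation by `g` relates the left invariant fields of `Z` and `Ad_g Z`, and the bracket of
vector fields commutes with pullback along local diffeomorphisms. -/
theorem lieGroupAd_lie [CompleteSpace EG] (g : G) (X Y : GroupLieAlgebra 𝓘(ℝ, EG) G) :
    lieGroupAd g ⁅X, Y⁆ = ⁅lieGroupAd g X, lieGroupAd g Y⁆ := by
  have hf : ∀ Z : GroupLieAlgebra 𝓘(ℝ, EG) G, VectorField.mpullback 𝓘(ℝ, EG) 𝓘(ℝ, EG)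
      (fun a : G => g * a * g⁻¹) (mulInvariantVectorField (lieGroupAd g Z)) =
      mulInvariantVectorField Z := by
    intro Z
    ext a
    obtain ⟨D, hD⟩ := exists_equiv_modelDeriv_conj (EG := EG) g a
    refine mpullback_eq_of_mfderiv_eq hD ?_
    rw [← hD]
    exact modelDeriv_conj_mulInvariantVectorField g a Z
  have h1 : g * 1 * g⁻¹ = 1 := by simp
  have h := VectorField.mpullback_mlieBracket (n := ∞) (x₀ := (1 : G))
    (f := fun a : G => g * a * g⁻¹)
    (mdifferentiableAt_mulInvariantVectorField (lieGroupAd g X))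
    (mdifferentiableAt_mulInvariantVectorField (lieGroupAd g Y))
    (contMDiff_conj g).contMDiffAt
    (by rw [minSmoothness_of_isRCLikeNormedField]; exact ENat.LEInfty.out)
  rw [hf, hf] at h
  have h2 : VectorField.mpullback 𝓘(ℝ, EG) 𝓘(ℝ, EG) (fun a : G => g * a * g⁻¹)
      (VectorField.mlieBracket 𝓘(ℝ, EG) (mulInvariantVectorField (lieGroupAd g X))
      (mulInvariantVectorField (lieGroupAd g Y))) 1 = (lieGroupAdEquiv (EG := EG) g).symm
        ⁅lieGroupAd g X, lieGroupAd g Y⁆ := by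
    have h3 : (lieGroupAd g : GroupLieAlgebra 𝓘(ℝ, EG) G →L[ℝ] GroupLieAlgebra 𝓘(ℝ, EG) G).inverse =
        (lieGroupAdEquiv (EG := EG) g).symm := by
      rw [← ContinuousLinearMap.inverse_equiv]; rfl
    rw [GroupLieAlgebra.bracket_def]
    refine (congrArg (fun l : EG →L[ℝ] EG => l _) h3).trans ?_
    exact congrArg (lieGroupAdEquiv (EG := EG) g).symm (vectorField_congr (EM := EG)
      (VectorField.mlieBracket 𝓘(ℝ, EG) (mulInvariantVectorField (lieGroupAd g X))
        (mulInvariantVectorField (lieGroupAd g Y))) h1)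
  have h4 : lieGroupAdEquiv (EG := EG) g ((lieGroupAdEquiv (EG := EG) g).symm
        ⁅lieGroupAd g X, lieGroupAd g Y⁆) = lieGroupAdEquiv (EG := EG) g ⁅X, Y⁆ :=
    congrArg (lieGroupAdEquiv (EG := EG) g) (h2.symm.trans h)
  rw [ContinuousLinearEquiv.apply_symm_apply] at h4
  exact h4.symm

/-- The derivative of a smooth family of maps is smooth in the parameter. Conjugations all fix `1`,
so the tangent coordinates in that statement disappear. -/
theorem contMDiff_lieGroupAd_apply (X : EG) :
    ContMDiff 𝓘(ℝ, EG) 𝓘(ℝ, EG) ∞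
      (fun g : G => (modelDeriv (fun a : G => g * a * g⁻¹) (1 : G) : EG →L[ℝ] EG) X) := by
  intro g
  have : IsManifold 𝓘(ℝ, EG) 1 G := IsManifold.of_le (n := ∞) (by simp)
  have hf : ContMDiff (𝓘(ℝ, EG).prod 𝓘(ℝ, EG)) 𝓘(ℝ, EG) ∞
      (Function.uncurry fun h a : G => h * a * h⁻¹) :=
    (contMDiff_fst.mul contMDiff_snd).mul contMDiff_fst.inv
  let φ : G → EG →L[ℝ] EG := fun g => modelDeriv (fun a : G => g * a * g⁻¹) (1 : G)
  have h : ContMDiffAt 𝓘(ℝ, EG) 𝓘(ℝ, EG →L[ℝ] EG) ∞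
      (inTangentCoordinates 𝓘(ℝ, EG) 𝓘(ℝ, EG) (fun _ : G => (1 : G)) (fun x => x * 1 * x⁻¹) φ g) g :=
    ContMDiffAt.mfderiv (fun h a : G => h * a * h⁻¹) (fun _ : G => (1 : G))
      hf.contMDiffAt contMDiffAt_const (by simp)
  have h1 : inTangentCoordinates 𝓘(ℝ, EG) 𝓘(ℝ, EG) (fun _ : G => (1 : G)) (fun x => x * 1 * x⁻¹) φ g
      = φ := by
    ext x v
    exact inTangentCoordinates_apply_of_eq (f := fun _ : G => (1 : G))
      (g := fun x : G => x * 1 * x⁻¹) φ rfl (by simp) v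
  rw [h1] at h
  exact h.clm_apply contMDiffAt_const

/-- The derivative of the adjoint representation of a subgroup is the Lie bracket. -/
theorem modelDeriv_lieGroupAd [CompleteSpace EG]
    {EP : Type*} [NormedAddCommGroup EP] [NormedSpace ℝ EP]
    {P : Subgroup G} [ChartedSpace EP P] [IsManifold 𝓘(ℝ, EP) ∞ P]
    (hι : ContMDiff 𝓘(ℝ, EP) 𝓘(ℝ, EG) ∞ (fun h : P => (h : G)))
    (X : GroupLieAlgebra 𝓘(ℝ, EP) P) (Y : GroupLieAlgebra 𝓘(ℝ, EG) G) :
    (modelDeriv (N := EG) (fun h : P => lieGroupAd (EG := EG) (h : G) Y) 1 : EP →L[ℝ] EG) X =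
      ⁅lieSubgroupIncl (EG := EG) P X, Y⁆ := by
  rw [GroupLieAlgebra.bracket_def]
  refine (mlieBracket_eq_mfderiv_of_act (EM := EG) (EN := EP) (m := fun (a : G) (h : P) => a * h) ?_ (n₀ := 1) (by simp)
    (X := X) ?_ ?_ ?_ ?_).symm
  · exact contMDiff_fst.mul (hι.comp contMDiff_snd)
  · intro a
    have h := modelDeriv_comp (f := fun h : P => (h : G)) (x := 1)
      (mdifferentiableAt_mul_left' (EG := EG) a 1) rfl (hι.contMDiffAt.mdifferentiableAt (by simp))
    exact (congrArg (fun l : EP →L[ℝ] EG => l X) h).symm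
  · exact mdifferentiableAt_mulInvariantVectorField Y
  · exact ((contMDiff_lieGroupAd_apply (EG := EG) Y).comp hι).contMDiffAt.mdifferentiableAt (by simp)
  -- Here `b h = Ad_h Y`: from `(h a h⁻¹) h = h a`, right translation by `h` carries `Ad_h Y` to the
  -- value at `h` of the left invariant field of `Y`.
  · intro h
    have h1 := modelDeriv_comp (mdifferentiableAt_mul_right' (EG := EG) (h : G) 1) (by simp)
      (mdifferentiableAt_conj (EG := EG) (h : G) 1)
    have h2 : (fun a : G => (h : G) * a * (h : G)⁻¹ * h) = fun a => (h : G) * a := by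
      ext a; group
    rw [h2] at h1
    refine (congrArg (fun l : EG →L[ℝ] EG => l Y) h1).symm.trans ?_
    exact vectorField_congr (mulInvariantVectorField Y) (one_mul (h : G)).symm
end

/-! ### Constant fields and the curvature: naturality, equivariance, horizontality. -/

namespace CartanGeometry

variable {EG : Type*} [NormedAddCommGroup EG] [NormedSpace ℝ EG]
  {G : Type*} [TopologicalSpace G] [ChartedSpace EG G] [Group G]
  {EP : Type*} [NormedAddCommGroup EP] [NormedSpace ℝ EP]
  {P : Subgroup G} [ChartedSpace EP P]
  {EM : Type*} [NormedAddCommGroup EM] [NormedSpace ℝ EM]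
  {M : Type*} [TopologicalSpace M] [ChartedSpace EM M]
  {EB : Type*} [NormedAddCommGroup EB] [NormedSpace ℝ EB]
  {B : Type*} [TopologicalSpace B] [ChartedSpace EB B] [IsManifold 𝓘(ℝ, EB) ∞ B]
  (𝒢 : CartanGeometry (EG := EG) (EP := EP) (EM := EM) (EB := EB) P M B)

/-- The Cartan connection at a point, as an equivalence of model spaces. -/
noncomputable def connModel (u : B) : EB ≃L[ℝ] EG := 𝒢.conn u

theorem contMDiff_act_right (h : P) :
    ContMDiff 𝓘(ℝ, EB) 𝓘(ℝ, EB) ∞ (fun v : B => 𝒢.act v h) :=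
  𝒢.contMDiff_act.comp (contMDiff_id.prodMk contMDiff_const)

theorem curvature_swap [CompleteSpace EG] [LieGroup 𝓘(ℝ, EG) ∞ G]
    (u : B) (X Y : GroupLieAlgebra 𝓘(ℝ, EG) G) :
    𝒢.curvature u X Y = -𝒢.curvature u Y X := by
  rw [curvature, curvature, VectorField.mlieBracket_swap_apply, map_neg, ← lie_skew]
  abel

variable [FiniteDimensional ℝ EG] [FiniteDimensional ℝ EB]

/-- In a local trivialization, `ω` becomes a family of invertible operators `A v`, and the constant
field is `(A v)⁻¹ X`; inversion of operators is smooth. -/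
theorem mdifferentiableAt_constField (X : GroupLieAlgebra 𝓘(ℝ, EG) G) (u : B) :
    MDifferentiableAt 𝓘(ℝ, EB) 𝓘(ℝ, EB).tangent
      (fun v => (⟨v, 𝒢.constField X v⟩ : TangentBundle 𝓘(ℝ, EB) B)) u := by
  have : IsManifold 𝓘(ℝ, EB) 1 B := IsManifold.of_le (n := ∞) (by simp)
  have : CompleteSpace EB := FiniteDimensional.complete ℝ EB
  rw [mdifferentiableAt_section]
  let t := trivializationAt EB (TangentSpace 𝓘(ℝ, EB) : B → Type _) u
  have ht : t.baseSet ∈ nhds u :=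
    t.open_baseSet.mem_nhds (FiberBundle.mem_baseSet_trivializationAt' u)
  let A : B → EB →L[ℝ] EG := fun v =>
    (𝒢.connModel v : EB →L[ℝ] EG).comp (t.symmL ℝ v : EB →L[ℝ] EB)
  have hAp : ∀ w : EB, ContMDiffAt 𝓘(ℝ, EB) 𝓘(ℝ, EG) ∞ (fun v => A v w) u := by
    intro w
    have h1 : ContMDiffAt 𝓘(ℝ, EB) 𝓘(ℝ, EB).tangent ∞
        (fun v => t.toOpenPartialHomeomorph.symm (v, w)) u := by
      refine ContMDiffAt.comp u (t.contMDiffOn_symm.contMDiffAt ?_)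
        (contMDiffAt_id.prodMk contMDiffAt_const)
      rw [t.target_eq]
      exact prod_mem_nhds ht Filter.univ_mem
    refine (𝒢.contMDiff_conn.contMDiffAt.comp u h1).congr_of_eventuallyEq ?_
    filter_upwards [ht] with v hv
    have h2 : 𝒢.connModel v (t.symm v w) = 𝒢.conn (t.toOpenPartialHomeomorph.symm (v, w)).1
        (t.toOpenPartialHomeomorph.symm (v, w)).2 := by
      rw [← t.mk_symm hv w]
      rfl
    refine Eq.trans ?_ h2
    exact congrArg (𝒢.connModel v) (t.symmL_apply hv w)
  -- Smoothness of `ω` on the tangent bundle only controls `A v w` for each fixed `w`. As `EB` is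
  -- finite dimensional, `A v` depends linearly and continuously on its values on a basis, which
  -- gives differentiability as an operator.
  have hA : MDifferentiableAt 𝓘(ℝ, EB) 𝓘(ℝ, EB →L[ℝ] EG) A u := by
    let bs := Module.finBasis ℝ EB
    let Φ : (Fin (Module.finrank ℝ EB) → EG) →L[ℝ] (EB →L[ℝ] EG) :=
      LinearMap.toContinuousLinearMap
        ((LinearMap.toContinuousLinearMap (𝕜 := ℝ) (E := EB) (F' := EG)).toLinearMap.comp
          (bs.constr ℝ).toLinearMap)
    have h1 : A = fun v => Φ (fun i => A v (bs i)) := by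
      ext1 v
      apply ContinuousLinearMap.coe_injective
      refine bs.ext fun i => ?_
      simp [Φ]
    rw [h1]
    exact Φ.differentiableAt.mdifferentiableAt.comp u
      ((contMDiffAt_pi_space.2 fun i => hAp _).mdifferentiableAt (by simp))
  have hAe : ∀ v ∈ t.baseSet, ∃ D : EB ≃L[ℝ] EG, A v = (D : EB →L[ℝ] EG) ∧
      D.symm X = (t ⟨v, 𝒢.constField X v⟩).2 := by
    intro v hv
    refine ⟨(t.continuousLinearEquivAt ℝ v hv).symm.trans (𝒢.conn v), ?_, ?_⟩
    · ext w
      exact congrArg (𝒢.connModel v) (congrFun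
        (t.symm_continuousLinearEquivAt_eq (R := ℝ) hv) w).symm
    · rfl
  obtain ⟨D, hD, -⟩ := hAe u (mem_of_mem_nhds ht)
  have hinv : DifferentiableAt ℝ (ContinuousLinearMap.inverse : (EB →L[ℝ] EG) → _) (A u) := by
    rw [hD]
    exact (contDiffAt_map_inverse (n := 1) D).differentiableAt (by simp)
  have h3 : MDifferentiableAt 𝓘(ℝ, EB) 𝓘(ℝ, EB) (fun v => (A v).inverse (X : EG)) u :=
    (hinv.mdifferentiableAt.comp u hA).clm_apply mdifferentiableAt_const
  refine h3.congr_of_eventuallyEq ?_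
  filter_upwards [ht] with v hv
  obtain ⟨D, hD, hX⟩ := hAe v hv
  rw [hD, ContinuousLinearMap.inverse_equiv]
  exact hX.symm

variable {𝒢} in
/-- A local diffeomorphism `f` with `f^* ω = T ∘ ω` maps brackets of constant fields to brackets of
constant fields. -/
theorem conn_mlieBracket_of_related {f : B → B} {u : B}
    (hf : ContMDiffAt 𝓘(ℝ, EB) 𝓘(ℝ, EB) ∞ f u)
    (T : GroupLieAlgebra 𝓘(ℝ, EG) G ≃L[ℝ] GroupLieAlgebra 𝓘(ℝ, EG) G)
    (h : ∀ᶠ v in nhds u, ∀ ξ : EB, 𝒢.connModel (f v) ((modelDeriv f v : EB →L[ℝ] EB) ξ) =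
      T (𝒢.conn v ξ)) (X Y : GroupLieAlgebra 𝓘(ℝ, EG) G) :
    𝒢.conn (f u) (VectorField.mlieBracket 𝓘(ℝ, EB) (𝒢.constField (T X)) (𝒢.constField (T Y))
      (f u)) = T (𝒢.conn u
        (VectorField.mlieBracket 𝓘(ℝ, EB) (𝒢.constField X) (𝒢.constField Y) u)) := by
  have : CompleteSpace EB := FiniteDimensional.complete ℝ EB
  have : IsManifold 𝓘(ℝ, EB) 2 B := IsManifold.of_le (n := ∞) ENat.LEInfty.out
  have : IsManifold 𝓘(ℝ, EB) (minSmoothness ℝ 2) B :=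
    IsManifold.of_le (n := ∞) (by rw [minSmoothness_of_isRCLikeNormedField]; exact ENat.LEInfty.out)
  have : IsManifold 𝓘(ℝ, EB) (minSmoothness ℝ 3) B :=
    IsManifold.of_le (n := ∞) (by rw [minSmoothness_of_isRCLikeNormedField]; exact ENat.LEInfty.out)
  let T' : EG ≃L[ℝ] EG := T
  -- The relation `f^* ω = T ∘ ω` forces the derivative of `f` to be `ω⁻¹ ∘ T ∘ ω`, hence
  -- invertible, so `f` can pull back fields.
  let D : B → EB ≃L[ℝ] EB := fun v =>
    ((𝒢.connModel v).trans T').trans (𝒢.connModel (f v)).symm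
  have hD : ∀ᶠ v in nhds u, modelDeriv f v = (D v : EB →L[ℝ] EB) := by
    filter_upwards [h] with v hv
    ext ξ
    exact (𝒢.connModel (f v)).eq_symm_apply.2 (hv ξ)
  have hp : ∀ Z, VectorField.mpullback 𝓘(ℝ, EB) 𝓘(ℝ, EB) f (𝒢.constField (T Z)) =ᶠ[nhds u]
      𝒢.constField Z := by
    intro Z
    filter_upwards [hD] with v hv
    refine mpullback_eq_of_mfderiv_eq hv ?_
    exact congrArg (fun W => (𝒢.connModel (f v)).symm (T' W)) ((𝒢.conn v).apply_symm_apply Z)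
  have h1 := VectorField.mpullback_mlieBracket (n := ∞)
    (𝒢.mdifferentiableAt_constField (T X) (f u)) (𝒢.mdifferentiableAt_constField (T Y) (f u)) hf
    (by rw [minSmoothness_of_isRCLikeNormedField]; exact ENat.LEInfty.out)
  rw [(hp X).mlieBracket_vectorField_eq (hp Y)] at h1
  have h2 : (D u).symm (VectorField.mlieBracket 𝓘(ℝ, EB) (𝒢.constField (T X))
      (𝒢.constField (T Y)) (f u)) =
      VectorField.mlieBracket 𝓘(ℝ, EB) (𝒢.constField X) (𝒢.constField Y) u := by
    refine Eq.trans ?_ h1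
    have h3 : (modelDeriv f u : EB →L[ℝ] EB).inverse = (D u).symm := by
      rw [hD.self_of_nhds, ContinuousLinearMap.inverse_equiv]
    exact (congrArg (fun l : EB →L[ℝ] EB => l _) h3).symm
  have h4 := (D u).symm_apply_eq.1 h2
  exact (congrArg (𝒢.connModel (f u)) h4).trans ((𝒢.connModel (f u)).apply_symm_apply _)

variable {𝒢} in
theorem IsLocalAutomorphism.curvature_eq {U V : Set M} {φ : OpenPartialHomeomorph B B}
    (hφ : 𝒢.IsLocalAutomorphism U V φ) {u : B} (hu : u ∈ φ.source)
    (X Y : GroupLieAlgebra 𝓘(ℝ, EG) G) :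
    𝒢.curvature (φ u) X Y = 𝒢.curvature u X Y := by
  rw [curvature, curvature]
  congr 1
  exact conn_mlieBracket_of_related (hφ.contMDiffOn.contMDiffAt (φ.open_source.mem_nhds hu))
    (ContinuousLinearEquiv.refl ℝ _)
    (by filter_upwards [φ.open_source.mem_nhds hu] with v hv ξ using hφ.pullback_conn v hv ξ) X Y

variable [CompleteSpace EG] [LieGroup 𝓘(ℝ, EG) ∞ G]

theorem curvature_add_left (u : B) (X X' Y : GroupLieAlgebra 𝓘(ℝ, EG) G) :
    𝒢.curvature u (X + X') Y = 𝒢.curvature u X Y + 𝒢.curvature u X' Y := by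
  have : CompleteSpace EB := FiniteDimensional.complete ℝ EB
  have : IsManifold 𝓘(ℝ, EB) 2 B := IsManifold.of_le (n := ∞) ENat.LEInfty.out
  have h : 𝒢.constField (X + X') = 𝒢.constField X + 𝒢.constField X' := by
    ext v
    exact map_add (𝒢.conn v).symm X X'
  rw [curvature, curvature, curvature, h, VectorField.mlieBracket_add_left
    (𝒢.mdifferentiableAt_constField X u) (𝒢.mdifferentiableAt_constField X' u), map_add, add_lie]
  abel

/-- Right translation by `h` pulls `ω` back to `Ad_{h⁻¹} ∘ ω`, and `Ad_{h⁻¹}` preserves the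
algebraic bracket, so both terms of the curvature transform alike. -/
theorem curvature_act (u : B) (h : P) (X Y : GroupLieAlgebra 𝓘(ℝ, EG) G) :
    𝒢.curvature (𝒢.act u h) (lieGroupAd (h : G)⁻¹ X) (lieGroupAd (h : G)⁻¹ Y) =
      lieGroupAd (h : G)⁻¹ (𝒢.curvature u X Y) := by
  rw [curvature, curvature, map_sub, lieGroupAd_lie (EG := EG)]
  congr 1
  exact conn_mlieBracket_of_related (𝒢.contMDiff_act_right h).contMDiffAt
    (lieGroupAdEquiv (EG := EG) (h : G)⁻¹)
    (Filter.Eventually.of_forall fun v ξ => 𝒢.equivariant h v ξ) X Y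

/-- The curvature is horizontal. -/
theorem curvature_lieSubgroupIncl [LieGroup 𝓘(ℝ, EP) ∞ P]
    (hι : ContMDiff 𝓘(ℝ, EP) 𝓘(ℝ, EG) ∞ (fun h : P => (h : G)))
    (u : B) (X : GroupLieAlgebra 𝓘(ℝ, EP) P) (Y : GroupLieAlgebra 𝓘(ℝ, EG) G) :
    𝒢.curvature u (lieSubgroupIncl P X) Y = 0 := by
  have : CompleteSpace EB := FiniteDimensional.complete ℝ EB
  -- By equivariance, right translation by `h` carries this vector at `u` to `ω⁻¹(Y)` at `u · h`.
  -- Hence the bracket of the fundamental field with `ω⁻¹(Y)` is the derivative of `b`, that is,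
  -- `ω⁻¹` of the derivative of `Ad`.
  let b : P → EB := fun h => (𝒢.connModel u).symm (lieGroupAd (EG := EG) (h : G) Y)
  have hAd : MDifferentiableAt 𝓘(ℝ, EP) 𝓘(ℝ, EG)
      (fun h : P => (modelDeriv (fun a : G => (h : G) * a * (h : G)⁻¹) 1 : EG →L[ℝ] EG) Y) 1 :=
    ((contMDiff_lieGroupAd_apply (EG := EG) Y).comp hι).contMDiffAt.mdifferentiableAt (by simp)
  have hsymm : ∀ y : EG, HasMFDerivAt 𝓘(ℝ, EG) 𝓘(ℝ, EB) (𝒢.connModel u).symm y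
      ((𝒢.connModel u).symm : EG →L[ℝ] EB) := fun y =>
    (𝒢.connModel u).symm.hasFDerivAt.hasMFDerivAt
  have hb := (hsymm _).comp_model rfl hAd.hasMFDerivAt_modelDeriv
  have hbr : VectorField.mlieBracket 𝓘(ℝ, EB) (𝒢.constField (lieSubgroupIncl P X))
      (𝒢.constField Y) u = (modelDeriv b 1 : EP →L[ℝ] EB) X := by
    refine mlieBracket_eq_mfderiv_of_act (EM := EB) (EN := EP) (m := 𝒢.act) 𝒢.contMDiff_act
      𝒢.act_one ?_ (𝒢.mdifferentiableAt_constField Y u) hb.mdifferentiableAt ?_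
    · intro v
      exact (𝒢.conn v).symm_apply_eq.2 (𝒢.fundamental X v).symm
    · intro h
      refine (𝒢.conn (𝒢.act u h)).eq_symm_apply.2 ?_
      refine (𝒢.equivariant h u (b h)).trans ?_
      have h1 : 𝒢.conn u (b h) = lieGroupAd (h : G) Y := (𝒢.connModel u).apply_symm_apply _
      rw [h1, ← lieGroupAd_mul_apply, inv_mul_cancel, lieGroupAd_one_apply]
  have h2 : 𝒢.conn u ((modelDeriv b 1 : EP →L[ℝ] EB) X) = ⁅lieSubgroupIncl (EG := EG) P X, Y⁆ := by
    rw [← modelDeriv_lieGroupAd hι X Y]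
    refine (congrArg (fun l : EP →L[ℝ] EB => 𝒢.connModel u (l X)) (modelDeriv_eq hb)).trans ?_
    exact (𝒢.connModel u).apply_symm_apply _
  rw [curvature, hbr, h2, sub_self]

end CartanGeometry

/-! ### Consequences of the grading. -/

theorem LieGrading.filtration_neg_one_eq_top {L : Type*} [LieRing L] [LieAlgebra ℝ L]
    (gr : LieGrading 1 L) : gr.filtration (-1) = ⊤ := by
  rw [eq_top_iff, ← gr.isInternal.submodule_iSup_eq_top]
  refine iSup_le fun i => ?_
  by_cases hi : -1 ≤ i
  · exact le_iSup_of_le i (le_iSup_of_le hi le_rfl)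
  · rw [gr.piece_eq_bot i (by rw [lt_abs]; right; push_cast; omega)]
    exact bot_le

theorem LieGrading.component_eq_zero_of_mem_parabolic {k : ℕ} {L : Type*} [LieRing L]
    [LieAlgebra ℝ L] (gr : LieGrading k L) {i : ℤ} (hi : i < 0) {X : L} (hX : X ∈ gr.parabolic) :
    gr.component i X = 0 := by
  let := gr.isInternal.chooseDecomposition
  let p : L →ₗ[ℝ] L := (gr.piece i).subtype.comp ((DirectSum.component ℝ ℤ (fun j => gr.piece j) i).comp
    (DirectSum.decomposeLinearEquiv gr.piece).toLinearMap)
  have hp : gr.parabolic ≤ LinearMap.ker p := by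
    refine iSup_le fun j => iSup_le fun hj => fun Y hY => ?_
    rw [LinearMap.mem_ker]
    exact DirectSum.decompose_of_mem_ne gr.piece hY (by omega)
  exact hp hX

/-! ### Fibres and vertical vectors of a principal bundle. -/

namespace PrincipalBundle

variable {EP : Type*} [NormedAddCommGroup EP] [NormedSpace ℝ EP]
    {P : Type*} [TopologicalSpace P] [ChartedSpace EP P] [Group P]
    {EM : Type*} [NormedAddCommGroup EM] [NormedSpace ℝ EM]
    {M : Type*} [TopologicalSpace M] [ChartedSpace EM M]
    {EB : Type*} [NormedAddCommGroup EB] [NormedSpace ℝ EB]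
    {B : Type*} [TopologicalSpace B] [ChartedSpace EB B]
    (E : PrincipalBundle (EP := EP) (EM := EM) (EB := EB) P M B)

/-- In a trivialization, points of one fibre differ only in the `P` coordinate, on which `P` acts by
right multiplication. -/
theorem exists_act_eq {u v : B} (h : E.proj v = E.proj u) : ∃ g, v = E.act u g := by
  obtain ⟨U, Ψ, -, hxU, hs, -, -, -, h1, h2⟩ := E.exists_trivialization (E.proj u)
  have hu : u ∈ Ψ.source := by rw [hs]; exact hxU
  have hv : v ∈ Ψ.source := by rw [hs, Set.mem_preimage, h]; exact hxU
  refine ⟨(Ψ u).2⁻¹ * (Ψ v).2, Ψ.injOn hv ?_ ?_⟩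
  · rw [hs, Set.mem_preimage, E.proj_act]; exact hxU
  · rw [h2 u hu]
    ext
    · rw [h1 u hu, h1 v hv, h]
    · simp

/-- Vectors in the kernel of the derivative of the projection are values of fundamental fields. -/
theorem exists_fundamentalField_eq [LieGroup 𝓘(ℝ, EP) ∞ P] {u : B} {ξ : EB}
    (hξ : (modelDeriv E.proj u : EB →L[ℝ] EM) ξ = 0) :
    ∃ X : GroupLieAlgebra 𝓘(ℝ, EP) P, E.fundamentalField X u = ξ := by
  obtain ⟨U, Ψ, hU, hxU, hs, ht, hΨ, hΨs, h1, h2⟩ := E.exists_trivialization (E.proj u)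
  have hu : u ∈ Ψ.source := by rw [hs]; exact hxU
  set a := (Ψ u).2 with ha
  have hΨu : Ψ u = (E.proj u, a) := Prod.ext (h1 u hu) rfl
  have hproj : HasMFDerivAt 𝓘(ℝ, EB) 𝓘(ℝ, EM) E.proj u (modelDeriv E.proj u : EB →L[ℝ] EM) :=
    (E.contMDiff_proj.contMDiffAt.mdifferentiableAt (by simp)).hasMFDerivAt_modelDeriv
  have hsnd : MDifferentiableAt 𝓘(ℝ, EB) 𝓘(ℝ, EP) (fun v => (Ψ v).2) u :=
    (contMDiffAt_snd.comp u (hΨ.contMDiffAt (Ψ.open_source.mem_nhds hu))).mdifferentiableAt (by simp)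
  have hpair := hproj.prodMk hsnd.hasMFDerivAt_modelDeriv
  have hsymm : MDifferentiableAt (𝓘(ℝ, EM).prod 𝓘(ℝ, EP)) 𝓘(ℝ, EB) Ψ.symm (E.proj u, a) :=
    (hΨs.contMDiffAt (Ψ.open_target.mem_nhds (hΨu ▸ Ψ.map_source hu))).mdifferentiableAt (by simp)
  obtain ⟨D, hD⟩ : ∃ D : EM × EP →L[ℝ] EB, HasMFDerivAt (𝓘(ℝ, EM).prod 𝓘(ℝ, EP)) 𝓘(ℝ, EB) Ψ.symm
      (E.proj u, a) D := ⟨_, hsymm.hasMFDerivAt⟩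
  -- Differentiating `Ψ⁻¹ ∘ Ψ = id` and using that the base component of `ξ` vanishes.
  have hDξ : D (0, (modelDeriv (fun v => (Ψ v).2) u : EB →L[ℝ] EP) ξ) = ξ := by
    have h3 : HasMFDerivAt 𝓘(ℝ, EB) 𝓘(ℝ, EB) (fun v : B => v) u
        (D.comp ((modelDeriv E.proj u : EB →L[ℝ] EM).prod
          (modelDeriv (fun v => (Ψ v).2) u : EB →L[ℝ] EP))) := by
      refine HasMFDerivAt.congr_of_eventuallyEq (HasMFDerivAt.comp u hD hpair) ?_
      filter_upwards [Ψ.open_source.mem_nhds hu] with v hv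
      have h4 : (E.proj v, (Ψ v).2) = Ψ v := Prod.ext (h1 v hv).symm rfl
      rw [Function.comp_apply, h4, Ψ.left_inv hv]
    have h5 := congrArg (fun l : EB →L[ℝ] EB => l ξ) ((modelDeriv_eq h3).symm.trans modelDeriv_id)
    have h6 : D ((modelDeriv E.proj u : EB →L[ℝ] EM) ξ,
      (modelDeriv (fun v => (Ψ v).2) u : EB →L[ℝ] EP) ξ) = ξ := h5
    rwa [hξ] at h6
  set η := (modelDeriv (fun v => (Ψ v).2) u : EB →L[ℝ] EP) ξ with hη
  have hmul : HasMFDerivAt 𝓘(ℝ, EP) 𝓘(ℝ, EP) (fun h : P => a * h) 1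
      (modelDeriv (fun h : P => a * h) 1 : EP →L[ℝ] EP) :=
    (mdifferentiableAt_mul_left' a 1).hasMFDerivAt_modelDeriv
  -- In the trivialization the orbit map of `u` is `h ↦ (proj u, a h)`, so `X` must be the left
  -- translate of `η` back to the identity.
  obtain ⟨X, hX⟩ : ∃ X : EP, (modelDeriv (fun h : P => a * h) 1 : EP →L[ℝ] EP) X = η := by
    refine ⟨(modelDeriv (fun h : P => a⁻¹ * h) a : EP →L[ℝ] EP) η, ?_⟩
    have h3 := modelDeriv_comp (mdifferentiableAt_mul_left' (EG := EP) a 1) (inv_mul_cancel a)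
      (mdifferentiableAt_mul_left' (EG := EP) a⁻¹ a)
    simp only [mul_inv_cancel_left] at h3
    exact congrArg (fun l : EP →L[ℝ] EP => l η) (h3.symm.trans modelDeriv_id)
  refine ⟨X, ?_⟩
  have hact : HasMFDerivAt 𝓘(ℝ, EP) 𝓘(ℝ, EB) (fun h : P => E.act u h) 1
      (D.comp ((0 : EP →L[ℝ] EM).prod (modelDeriv (fun h : P => a * h) 1 : EP →L[ℝ] EP))) := by
    have h3 : HasMFDerivAt 𝓘(ℝ, EP) 𝓘(ℝ, EM) (fun _ : P => E.proj u) 1 (0 : EP →L[ℝ] EM) :=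
      hasMFDerivAt_const _ _
    have h4 := h3.prodMk hmul
    have h5 : HasMFDerivAt (𝓘(ℝ, EM).prod 𝓘(ℝ, EP)) 𝓘(ℝ, EB) Ψ.symm (E.proj u, a * 1) D := by
      rw [mul_one]; exact hD
    refine HasMFDerivAt.congr_of_eventuallyEq (HasMFDerivAt.comp 1 h5 h4)
      (Filter.Eventually.of_forall fun h => ?_)
    have h6 : E.act u h ∈ Ψ.source := by rw [hs, Set.mem_preimage, E.proj_act]; exact hxU
    rw [Function.comp_apply, ← h1 u hu, ← h2 u hu, Ψ.left_inv h6]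
  have h7 : (modelDeriv (fun h : P => E.act u h) 1 : EP →L[ℝ] EB) X = D (0, η) := by
    rw [modelDeriv_eq hact, ← hX]
    rfl
  exact h7.trans hDξ

end PrincipalBundle

/-! ### Symmetries and the vanishing of torsion. -/

namespace CartanGeometry

variable {EG : Type*} [NormedAddCommGroup EG] [NormedSpace ℝ EG]
  [CompleteSpace EG]
  {G : Type*} [TopologicalSpace G] [ChartedSpace EG G] [Group G] [LieGroup 𝓘(ℝ, EG) ∞ G]
  {EP : Type*} [NormedAddCommGroup EP] [NormedSpace ℝ EP]
  {P : Subgroup G} [ChartedSpace EP P] [LieGroup 𝓘(ℝ, EP) ∞ P]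
  {EM : Type*} [NormedAddCommGroup EM] [NormedSpace ℝ EM]
  {M : Type*} [TopologicalSpace M] [ChartedSpace EM M]
  {EB : Type*} [NormedAddCommGroup EB] [NormedSpace ℝ EB]
  {B : Type*} [TopologicalSpace B] [ChartedSpace EB B] [IsManifold 𝓘(ℝ, EB) ∞ B]
  {𝒢 : CartanGeometry (EG := EG) (EP := EP) (EM := EM) (EB := EB) P M B}

/-- If an automorphism over a symmetry with center `x` maps `u` to `u · g`, then `Ad_g` acts
as `-id` modulo `𝔭`. -/
theorem IsSymmetryAt.exists_lieGroupAd_add_eq {gr : LieGrading 1 (GroupLieAlgebra 𝓘(ℝ, EG) G)}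
    {x : M} {s : OpenPartialHomeomorph M M} (hs : 𝒢.IsSymmetryAt gr x s)
    {U V : Set M} {φ : OpenPartialHomeomorph B B} (hφ : 𝒢.IsLocalAutomorphism U V φ)
    (hcov : ∀ v ∈ φ.source, 𝒢.proj (φ v) = s (𝒢.proj v)) {u : B} (hu : u ∈ φ.source)
    (hux : 𝒢.proj u = x) {g : P} (hg : φ u = 𝒢.act u g) (X : GroupLieAlgebra 𝓘(ℝ, EG) G) :
    ∃ Z : GroupLieAlgebra 𝓘(ℝ, EP) P, lieGroupAd (g : G) X + X = lieSubgroupIncl P Z := by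
  have hproj : ∀ v, MDifferentiableAt 𝓘(ℝ, EB) 𝓘(ℝ, EM) 𝒢.proj v := fun v =>
    𝒢.contMDiff_proj.contMDiffAt.mdifferentiableAt (by simp)
  have hφd : MDifferentiableAt 𝓘(ℝ, EB) 𝓘(ℝ, EB) φ u :=
    (hφ.contMDiffOn.contMDiffAt (φ.open_source.mem_nhds hu)).mdifferentiableAt (by simp)
  have hsd : MDifferentiableAt 𝓘(ℝ, EM) 𝓘(ℝ, EM) s x :=
    (hs.contMDiffOn.contMDiffAt (s.open_source.mem_nhds hs.mem_source)).mdifferentiableAt (by simp)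
  have hactd : MDifferentiableAt 𝓘(ℝ, EB) 𝓘(ℝ, EB) (fun v => 𝒢.act v g) u :=
    (𝒢.contMDiff_act_right g).contMDiffAt.mdifferentiableAt (by simp)
  have h1 : (modelDeriv 𝒢.proj (𝒢.act u g) : EB →L[ℝ] EM).comp (modelDeriv φ u : EB →L[ℝ] EB) =
      (modelDeriv s x : EM →L[ℝ] EM).comp (modelDeriv 𝒢.proj u : EB →L[ℝ] EM) := by
    rw [← modelDeriv_comp (hproj _) hg hφd]
    refine modelDeriv_eq (HasMFDerivAt.congr_of_eventuallyEq (hsd.hasMFDerivAt_modelDeriv.comp_model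
      hux (hproj u).hasMFDerivAt_modelDeriv) ?_)
    filter_upwards [φ.open_source.mem_nhds hu] with v hv using hcov v hv
  have h2 : (modelDeriv 𝒢.proj (𝒢.act u g) : EB →L[ℝ] EM).comp
      (modelDeriv (fun v => 𝒢.act v g) u : EB →L[ℝ] EB) = modelDeriv 𝒢.proj u := by
    rw [← modelDeriv_comp (hproj _) rfl hactd]
    simp only [𝒢.proj_act]
  have h3 : (modelDeriv φ u : EB →L[ℝ] EB) (𝒢.constField X u) =
      𝒢.constField X (𝒢.act u g) := by
    refine Eq.trans ?_ (vectorField_congr (𝒢.constField X) hg)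
    refine (𝒢.connModel (φ u)).eq_symm_apply.2 ((hφ.pullback_conn u hu _).trans ?_)
    exact (𝒢.conn u).apply_symm_apply X
  have h4 : (modelDeriv (fun v => 𝒢.act v g) u : EB →L[ℝ] EB)
      (𝒢.constField (lieGroupAd (g : G) X) u) = 𝒢.constField X (𝒢.act u g) := by
    refine (𝒢.connModel (𝒢.act u g)).eq_symm_apply.2 ((𝒢.equivariant g u _).trans ?_)
    rw [constField, (𝒢.conn u).apply_symm_apply, ← lieGroupAd_mul_apply, inv_mul_cancel,
      lieGroupAd_one_apply]
  have h5 : (modelDeriv s x : EM →L[ℝ] EM) ((modelDeriv 𝒢.proj u : EB →L[ℝ] EM)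
      (𝒢.constField X u)) = -(modelDeriv 𝒢.proj u : EB →L[ℝ] EM) (𝒢.constField X u) :=
    hs.mfderiv_eq_neg _ ⟨u, hux, X, by rw [gr.filtration_neg_one_eq_top]; trivial, rfl⟩
  -- The projection of `ω⁻¹(X)` at `u · g` is computed in two ways: right translation carries
  -- `ω⁻¹(Ad_g X)(u)` there without changing its projection, while `φ` carries `ω⁻¹(X)(u)` there and
  -- acts on projections by `T_x s = -id`.
  have h6 : (modelDeriv 𝒢.proj u : EB →L[ℝ] EM) (𝒢.constField (lieGroupAd (g : G) X) u) =
      -(modelDeriv 𝒢.proj u : EB →L[ℝ] EM) (𝒢.constField X u) :=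
    (congrArg (fun l : EB →L[ℝ] EM => l (𝒢.constField (lieGroupAd (g : G) X) u)) h2).symm.trans
      ((congrArg (modelDeriv 𝒢.proj (𝒢.act u g) : EB →L[ℝ] EM) (h4.trans h3.symm)).trans
        ((congrArg (fun l : EB →L[ℝ] EM => l (𝒢.constField X u)) h1).trans h5))
  have h7 : (modelDeriv 𝒢.proj u : EB →L[ℝ] EM)
      (𝒢.constField (lieGroupAd (g : G) X + X) u) = 0 := by
    have h8 : (𝒢.constField (lieGroupAd (g : G) X + X) u : EB) =
        (𝒢.constField (lieGroupAd (g : G) X) u : EB) + (𝒢.constField X u : EB) :=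
      map_add (𝒢.conn u).symm _ _
    exact (congrArg (modelDeriv 𝒢.proj u : EB →L[ℝ] EM) h8).trans
      ((map_add _ _ _).trans (add_eq_zero_iff_eq_neg.2 h6))
  obtain ⟨Z, hZ⟩ := 𝒢.exists_fundamentalField_eq h7
  refine ⟨Z, ?_⟩
  rw [← 𝒢.fundamental Z u]
  exact ((𝒢.conn u).symm_apply_eq.1 hZ.symm)

variable [FiniteDimensional ℝ EG] [FiniteDimensional ℝ EB]

/-- The torsion vanishes at the center of a symmetry. -/
theorem IsSymmetryAt.curvature_mem_parabolic {gr : LieGrading 1 (GroupLieAlgebra 𝓘(ℝ, EG) G)}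
    (hP : IsParabolicSubgroup (EP := EP) gr P) {x : M} {s : OpenPartialHomeomorph M M}
    (hs : 𝒢.IsSymmetryAt gr x s) {u : B} (hux : 𝒢.proj u = x)
    (X Y : GroupLieAlgebra 𝓘(ℝ, EG) G) : 𝒢.curvature u X Y ∈ gr.parabolic := by
  have hι : ContMDiff 𝓘(ℝ, EP) 𝓘(ℝ, EG) ∞ (fun h : P => (h : G)) := hP.isSmoothEmbedding.contMDiff
  obtain ⟨U, V, φ, hxU, -, hφ, hcov⟩ := hs.covered
  have hu : u ∈ φ.source := by rw [hφ.source_eq, Set.mem_preimage, hux]; exact hxU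
  obtain ⟨g, hg⟩ := 𝒢.exists_act_eq (u := u) (v := φ u) (by rw [hcov u hu, hux, hs.map_center])
  have hAd := hs.exists_lieGroupAd_add_eq hφ hcov hu hux hg
  -- By horizontality, an argument matters only modulo `𝔭`, where `Ad_g` is `-id`.
  have hadd : ∀ X Y, 𝒢.curvature u (lieGroupAd (g : G) X) Y = -𝒢.curvature u X Y := by
    intro X Y
    obtain ⟨Z, hZ⟩ := hAd X
    rw [eq_neg_iff_add_eq_zero, ← curvature_add_left, hZ, curvature_lieSubgroupIncl _ hι]
  have hinv : 𝒢.curvature u (lieGroupAd (g : G) X) (lieGroupAd (g : G) Y) = 𝒢.curvature u X Y := by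
    rw [hadd, curvature_swap, hadd, curvature_swap 𝒢 u Y X]
    simp only [neg_neg]
  -- Equivariance at `φ u = u · g` reads `κ(φ u)(X, Y) = Ad_{g⁻¹} (κ(u)(Ad_g X, Ad_g Y))`; both
  -- curvature values equal `κ(u)(X, Y)`.
  have hfix : lieGroupAd (g : G) (𝒢.curvature u X Y) = 𝒢.curvature u X Y := by
    have h1 := 𝒢.curvature_act u g (lieGroupAd (g : G) X) (lieGroupAd (g : G) Y)
    simp only [← lieGroupAd_mul_apply, inv_mul_cancel, lieGroupAd_one_apply] at h1
    rw [← hg, hφ.curvature_eq hu, hinv] at h1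
    have h2 := congrArg (fun W => lieGroupAd (g : G) W) h1
    simp only [← lieGroupAd_mul_apply, mul_inv_cancel, lieGroupAd_one_apply] at h2
    exact h2
  -- The congruence `Ad_g ≡ -id` modulo `𝔭` is now applied to the value of the curvature, which
  -- `Ad_g` fixes.
  obtain ⟨Z, hZ⟩ := hAd (𝒢.curvature u X Y)
  have h2 : (2 : ℝ) • 𝒢.curvature u X Y ∈ gr.parabolic := by
    rw [two_smul]
    nth_rw 1 [← hfix]
    rw [hZ, ← hP.lieAlgebra_eq]
    exact LinearMap.mem_range_self _ Z
  exact (Submodule.smul_mem_iff _ two_ne_zero).1 h2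

end CartanGeometry

theorem mainTheorem1
    {EG : Type*} [NormedAddCommGroup EG] [NormedSpace ℝ EG] [FiniteDimensional ℝ EG]
    [CompleteSpace EG]
    {G : Type*} [TopologicalSpace G] [ChartedSpace EG G] [Group G] [LieGroup 𝓘(ℝ, EG) ∞ G]
    [LieAlgebra.IsSemisimple ℝ (GroupLieAlgebra 𝓘(ℝ, EG) G)]
    (gr : LieGrading 1 (GroupLieAlgebra 𝓘(ℝ, EG) G))
    {EP : Type*} [NormedAddCommGroup EP] [NormedSpace ℝ EP] [FiniteDimensional ℝ EP]
    (P : Subgroup G) [ChartedSpace EP P] [LieGroup 𝓘(ℝ, EP) ∞ P]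
    (hP : IsParabolicSubgroup (EP := EP) gr P)
    {EM : Type*} [NormedAddCommGroup EM] [NormedSpace ℝ EM] [FiniteDimensional ℝ EM]
    {M : Type*} [TopologicalSpace M] [ChartedSpace EM M] [IsManifold 𝓘(ℝ, EM) ∞ M]
    {EB : Type*} [NormedAddCommGroup EB] [NormedSpace ℝ EB] [FiniteDimensional ℝ EB]
    {B : Type*} [TopologicalSpace B] [ChartedSpace EB B] [IsManifold 𝓘(ℝ, EB) ∞ B]
    (𝒢 : CartanGeometry (EG := EG) (EP := EP) (EM := EM) (EB := EB) P M B) :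
    (𝒢.IsLocallySymmetric gr → 𝒢.IsTorsionFree gr) ∧
    (∀ x : M, (∃ s : OpenPartialHomeomorph M M, 𝒢.IsSymmetryAt gr x s) →
      ∀ u : B, 𝒢.proj u = x → ∀ X ∈ gr.piece (-1), ∀ Y ∈ gr.piece (-1),
        𝒢.curvatureComponent gr (-1) u X Y = 0) := by
  refine ⟨fun h u X Y => ?_, fun x ⟨s, hs⟩ u hu X _ Y _ => ?_⟩
  · obtain ⟨s, hs⟩ := h (𝒢.proj u)
    exact hs.curvature_mem_parabolic hP rfl X Y
  · exact gr.component_eq_zero_of_mem_parabolic (by norm_num)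
      (hs.curvature_mem_parabolic hP hu X Y)
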